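/- Let $\lambda_l,\mu>0$. Let $\Xi=\{(r_i,\theta_i)\}_{i\in\mathbb Z}$ be a Poisson point process on $\mathbb R\times[0,\pi)$ with intensity measure $\lambda_l\,dr\,\frac{d\theta}{\pi}$, and let $l(r_i,\theta_i)$ be the line in $\mathbb R^2$ that makes the angle $\theta_i$ with the $x$-axis (measured counterclockwise) and has signed distance $r_i$ from the origin, that is, $$l(r,\theta)=\{\,r(-\sin\theta,\cos\theta)+s(\cos\theta,\sin\theta): s\in\mathbb R\,\}.$$ Conditionally on these lines, let $\phi_i$, $i\in\mathbb Z$, be independent Poisson point processes such that $\phi_i$ lives on $l(r_i,\theta_i)$ and has intensity measure $\mu$ times the length on that line. Let $\Phi=\sum_{i}\phi_i$ be the resulting Poisson line Cox point process in $\mathbb R^2$. Then the distribution of $\Phi$ is invariant under all translations of the plane and under all rotations of the plane (by any angle about any point): if $T$ is such a map, then the image $T\Phi$ of $\Phi$ under $T$ has the same distribution as $\Phi$. -/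

import Mathlib

open MeasureTheory ProbabilityTheory Set
open scoped NNReal ENNReal

noncomputable section

/-- The Euclidean plane. -/
abbrev Plane : Type := EuclideanSpace ℝ (Fin 2)

/-- Counting measure of a set of points that is finite on compact sets. -/
def IsPointMeasure {E : Type*} [TopologicalSpace E] [MeasurableSpace E] (m : Measure E) : Prop :=
  ∃ s : Set E, (∀ K : Set E, IsCompact K → (s ∩ K).Finite) ∧ m = Measure.count.restrict s

/-- A (simple, locally finite) point process: a random measure which is almost surely the counting
measure of its points. `Measure E` carries the σ-algebra generated by the maps `m ↦ m B`. -/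
structure IsPointProcess {Ω E : Type*} [MeasurableSpace Ω] [TopologicalSpace E] [MeasurableSpace E]
    (P : Measure Ω) (N : Ω → Measure E) : Prop where
  measurable : Measurable N
  pointMeasure : ∀ᵐ ω ∂P, IsPointMeasure (N ω)

/-- Poisson point process with intensity measure `Λ`. -/
structure IsPoissonProcess {Ω E : Type*} [MeasurableSpace Ω] [TopologicalSpace E]
    [MeasurableSpace E] (P : Measure Ω) (N : Ω → Measure E) (Λ : Measure E) : Prop
    extends IsPointProcess P N where
  count : ∀ B : Set E, MeasurableSet B → Λ B ≠ ∞ →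
    P.map (fun ω => N ω B) =
      (poissonMeasure (Λ B).toNNReal).map (fun n : ℕ => (n : ℝ≥0∞))
  indep : ∀ (n : ℕ) (B : Fin n → Set E), (∀ j, MeasurableSet (B j)) →
    Pairwise (fun j k => Disjoint (B j) (B k)) →
    iIndepFun (fun j ω => N ω (B j)) P

/-- Conditionally on the σ-algebra `𝓖`, the point processes `φ i` are independent Poisson point
processes with the (random, `𝓖`-measurable, locally finite) intensity measures `Λ i`: given `𝓖`,
the numbers of points `φ i (B j)` in finitely many disjoint bounded Borel sets `B j` are, for all
`i` and `j` jointly, independent Poisson variables with the parameters `Λ i (B j)`. -/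
structure IsCondIndepPoisson {Ω ι E : Type*} (𝓖 : MeasurableSpace Ω) [mΩ : MeasurableSpace Ω]
    [PseudoMetricSpace E] [MeasurableSpace E] (P : Measure Ω) (φ : ι → Ω → Measure E)
    (Λ : ι → Ω → Measure E) : Prop where
  pointProcess : ∀ i, IsPointProcess P (φ i)
  condProb : ∀ (I : Finset ι) (n : ℕ) (B : Fin n → Set E), (∀ j, MeasurableSet (B j)) →
    (∀ j, Bornology.IsBounded (B j)) → Pairwise (fun j k => Disjoint (B j) (B k)) →
    ∀ c : ι → Fin n → ℕ,
      P⟦{ω | ∀ i ∈ I, ∀ j, φ i ω (B j) = (c i j : ℝ≥0∞)} | 𝓖⟧ =ᵐ[P]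
        fun ω => ∏ i ∈ I, ∏ j, (poissonMeasure (Λ i ω (B j)).toNNReal).real {c i j}

/-- The point with arc length parameter `s` on the line `l(r, θ)`, which makes the angle `θ` with
the `x`-axis and has signed distance `r` from the origin. -/
def linePoint (q : ℝ × ℝ) (s : ℝ) : Plane :=
  !₂[-q.1 * Real.sin q.2 + s * Real.cos q.2, q.1 * Real.cos q.2 + s * Real.sin q.2]

/-- The length measure on the line `l(r, θ)`, as a measure on the plane. -/
def lineLength (q : ℝ × ℝ) : Measure Plane := (volume : Measure ℝ).map (linePoint q)

/-- The measure `lam dr dθ/π` on the cylinder `ℝ × [0, π)`, as a measure on `ℝ × ℝ`. -/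
def lineIntensity (lam : ℝ≥0) : Measure (ℝ × ℝ) :=
  lam • (volume : Measure ℝ).prod
    (ENNReal.ofReal Real.pi⁻¹ • (volume : Measure ℝ).restrict (Ico 0 Real.pi))

/-- `Φ` is a Poisson line Cox point process with line intensity `lam` and linear point intensity
`mu`. Here `q i = (rᵢ, θᵢ)` are the points of the Poisson process on the cylinder, i.e. the lines,
and `φ i` is the process of the points put on the line `l(rᵢ, θᵢ)`. -/
def IsPoissonLineCox {Ω : Type*} [MeasurableSpace Ω] (P : Measure Ω) (lam mu : ℝ≥0)
    (Φ : Ω → Measure Plane) : Prop :=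
  ∃ (q : ℤ → Ω → ℝ × ℝ) (φ : ℤ → Ω → Measure Plane),
    (∀ i, Measurable (q i)) ∧
    (∀ i ω, (q i ω).2 ∈ Ico 0 Real.pi) ∧
    IsPoissonProcess P (fun ω => Measure.sum fun i => Measure.dirac (q i ω))
      (lineIntensity lam) ∧
    IsCondIndepPoisson (⨆ i, MeasurableSpace.comap (q i) inferInstance) P φ
      (fun i ω => mu • lineLength (q i ω)) ∧
    ∀ ω, Φ ω = Measure.sum fun i => φ i ω

/-- Rotation of the plane about the point `c` by the angle `α`. -/
def planeRotation (c : Plane) (α : ℝ) (x : Plane) : Plane :=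
  c + !₂[Real.cos α * (x 0 - c 0) - Real.sin α * (x 1 - c 1),
    Real.sin α * (x 0 - c 0) + Real.cos α * (x 1 - c 1)]

end

/-! The law of a random measure is determined by its Laplace functional `f ↦ E exp (-∫ f dΦ)` over
measurable `f` with values in `[0, ∞]` (`ext_of_laplace`), so it suffices to compute this functional
and to see that a rigid motion leaves it unchanged.

For a Poisson process of intensity `Λ` it equals `exp (-∫ (1 - exp (-f)) dΛ)`. Using this formula
first for the points given the lines and then for the lines themselves yields, for the Cox process,
`exp (-∫ (1 - exp (-g q)) d(lineIntensity lam))` with `g q = ∫ (1 - exp (-f)) d(mu • lineLength q)`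
(`IsPoissonLineCox.lintegral_expNeg`).

A rigid motion carries the length measure of the line `(r, θ)` to that of `(r + ρ θ, θ + α)`
(`map_rigidMotion_lineLength`). Integration over `r` absorbs `ρ θ`. The shift of `θ` is absorbed
because `(r, θ + π)` and `(-r, θ)` describe the same line, so the integral over `r` is `π`-periodic
in `θ` (`lintegral_lineIntensity_shear`). -/

noncomputable section

open Filter Topology

/-! ### The exponential on `[0, ∞]` -/

/-- The decreasing exponential `x ↦ exp (-x)` on `[0, ∞]`, with `expNeg ∞ = 0`. -/
def expNeg (x : ℝ≥0∞) : ℝ≥0∞ := EReal.exp (-(x : EReal))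

@[simp] lemma expNeg_zero : expNeg 0 = 1 := by simp [expNeg]

lemma expNeg_coe (x : ℝ≥0) : expNeg x = ENNReal.ofReal (Real.exp (-x)) := by
  rw [expNeg, ← EReal.exp_coe]
  rfl

lemma expNeg_le_one (x : ℝ≥0∞) : expNeg x ≤ 1 := by
  simp [expNeg, EReal.coe_ennreal_nonneg]

lemma expNeg_ne_top (x : ℝ≥0∞) : expNeg x ≠ ∞ :=
  ((expNeg_le_one x).trans_lt ENNReal.one_lt_top).ne

lemma expNeg_add (x y : ℝ≥0∞) : expNeg (x + y) = expNeg x * expNeg y := by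
  rw [expNeg, expNeg, expNeg, ← EReal.exp_add, EReal.coe_ennreal_add, EReal.neg_add, sub_eq_add_neg]
  · exact Or.inl (by simp)
  · exact Or.inr (by simp)

lemma continuous_expNeg : Continuous expNeg :=
  ENNReal.continuous_exp.comp (continuous_neg.comp continuous_coe_ennreal_ereal)

lemma measurable_expNeg : Measurable expNeg := continuous_expNeg.measurable

lemma antitone_expNeg : Antitone expNeg := fun x y h => by
  simpa [expNeg] using h

lemma expNeg_sum {ι : Type*} (s : Finset ι) (f : ι → ℝ≥0∞) :
    expNeg (∑ i ∈ s, f i) = ∏ i ∈ s, expNeg (f i) := by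
  classical
  induction s using Finset.induction_on with
  | empty => simp
  | insert a s ha ih => rw [Finset.sum_insert ha, Finset.prod_insert ha, expNeg_add, ih]

lemma expNeg_nsmul (n : ℕ) (x : ℝ≥0∞) : expNeg (n * x) = expNeg x ^ n := by
  simpa [nsmul_eq_mul] using expNeg_sum (Finset.range n) fun _ => x

/-- A measurable left inverse of `expNeg`. -/
def negLog (y : ℝ≥0∞) : ℝ≥0∞ := (-(ENNReal.log y)).toENNReal

lemma negLog_expNeg (x : ℝ≥0∞) : negLog (expNeg x) = x := by
  simp [negLog, expNeg]

lemma measurable_negLog : Measurable negLog :=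
  measurable_ereal_toENNReal.comp ENNReal.measurable_log.neg

/-! ### Laplace functionals determine distributions -/

/-- A finite measure on a finite power of the unit interval is determined by its moments. -/
lemma ext_of_moments {ι : Type*} [Fintype ι] {μ ν : Measure (ι → unitInterval)}
    [IsFiniteMeasure μ] [IsFiniteMeasure ν]
    (h : ∀ k : ι → ℕ, ∫ x, ∏ i, (x i : ℝ) ^ k i ∂μ = ∫ x, ∏ i, (x i : ℝ) ^ k i ∂ν) :
    μ = ν := by
  classical
  let e (i : ι) : BoundedContinuousFunction (ι → unitInterval) ℝ :=
    BoundedContinuousFunction.mkOfCompact ⟨fun x => (x i : ℝ), by fun_prop⟩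
  -- Polynomials in the coordinates separate points, so their integrals determine a finite measure;
  -- by linearity monomials suffice.
  let A : StarSubalgebra ℝ (BoundedContinuousFunction (ι → unitInterval) ℝ) :=
    { Algebra.adjoin ℝ (range e) with
      star_mem' := fun {a} ha => by
        have : star a = a := by ext; simp
        rw [this]; exact ha }
  have hmem (i : ι) : e i ∈ A := Algebra.subset_adjoin (mem_range_self i)
  refine ext_of_forall_mem_subalgebra_integral_eq_of_polish (𝕜 := ℝ) (A := A) ?_ ?_
  · intro x y hxy
    obtain ⟨i, hi⟩ := Function.ne_iff.1 hxy
    refine ⟨e i, ⟨_, ⟨e i, hmem i, rfl⟩, rfl⟩, ?_⟩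
    simpa [e, Subtype.ext_iff] using hi
  · intro g hg
    have hg' : g ∈ Submodule.span ℝ
        (Submonoid.closure (range e) : Set (BoundedContinuousFunction (ι → unitInterval) ℝ)) := by
      rw [← Algebra.adjoin_eq_span]; exact hg
    clear hg
    induction hg' using Submodule.span_induction with
    | mem x hx =>
      have : ∃ k : ι → ℕ, ∀ z, x z = ∏ i, (z i : ℝ) ^ k i := by
        induction hx using Submonoid.closure_induction with
        | mem x hx =>
          obtain ⟨i, rfl⟩ := hx
          refine ⟨Pi.single i 1, fun z => ?_⟩
          rw [Finset.prod_eq_single i] <;> simp +contextual [e]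
        | one => exact ⟨0, fun z => by simp⟩
        | mul x y hx hy ihx ihy =>
          obtain ⟨k, hk⟩ := ihx
          obtain ⟨l, hl⟩ := ihy
          exact ⟨k + l, fun z => by simp [hk, hl, pow_add, Finset.prod_mul_distrib]⟩
      obtain ⟨k, hk⟩ := this
      simp_rw [hk, h k]
    | zero => simp
    | add x y hx hy ihx ihy =>
      simp only [BoundedContinuousFunction.coe_add, Pi.add_apply]
      rw [integral_add (x.integrable _) (y.integrable _),
        integral_add (x.integrable _) (y.integrable _), ihx, ihy]
    | smul a x hx ihx =>
      simp only [BoundedContinuousFunction.coe_smul]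
      rw [integral_smul, integral_smul, ihx]

/-- The value of `expNeg` as a point of the unit interval. -/
def expNegUnit (x : ℝ≥0∞) : unitInterval :=
  ⟨(expNeg x).toReal, ENNReal.toReal_nonneg,
    ENNReal.toReal_le_of_le_ofReal zero_le_one (by simpa using expNeg_le_one x)⟩

lemma measurable_expNegUnit : Measurable expNegUnit :=
  measurable_expNeg.ennreal_toReal.subtype_mk

lemma negLog_expNegUnit (x : ℝ≥0∞) : negLog (ENNReal.ofReal (expNegUnit x)) = x := by
  rw [expNegUnit, ENNReal.ofReal_toReal (expNeg_ne_top x), negLog_expNeg]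

/-- The distribution of a random measure is determined by its Laplace functional. -/
theorem ext_of_laplace {E : Type*} [MeasurableSpace E] {μ ν : Measure (Measure E)}
    [IsFiniteMeasure μ] [IsFiniteMeasure ν]
    (h : ∀ f : E → ℝ≥0∞, Measurable f →
      ∫⁻ m, expNeg (∫⁻ x, f x ∂m) ∂μ = ∫⁻ m, expNeg (∫⁻ x, f x ∂m) ∂ν) :
    μ = ν := by
  classical
  let J (m : Measure E) (B : {B : Set E // MeasurableSet B}) : unitInterval := expNegUnit (m B)
  have hJ : Measurable J :=
    measurable_pi_lambda _ fun B => measurable_expNegUnit.comp (Measure.measurable_coe B.2)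
  -- `J` loses no information: `negLog` recovers each `m B` measurably from its coordinate.
  have hcomap : Measure.instMeasurableSpace ≤ MeasurableSpace.comap J inferInstance := by
    have : @Measurable _ _ (MeasurableSpace.comap J inferInstance) _ (id : Measure E → Measure E) := by
      refine @Measure.measurable_of_measurable_coe _ _ _ (MeasurableSpace.comap J inferInstance) _ ?_
      intro s hs
      have h1 : (fun m : Measure E => (id m) s) =
          (fun p : {B : Set E // MeasurableSet B} → unitInterval =>
            negLog (ENNReal.ofReal (p ⟨s, hs⟩))) ∘ J := by
        ext m; simp [J, negLog_expNegUnit]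
      rw [h1]
      refine Measurable.comp ?_ (comap_measurable J)
      exact measurable_negLog.comp
        (ENNReal.measurable_ofReal.comp (measurable_subtype_coe.comp (measurable_pi_apply _)))
    intro s hs
    exact this hs
  -- Finite measures on a product are determined by their finite-dimensional marginals, and those by
  -- their moments.
  have hmap : μ.map J = ν.map J := by
    refine IsProjectiveLimit.unique (P := fun I => (μ.map J).map I.restrict) (fun I => rfl) ?_
    intro I
    have hI : Measurable (I.restrict : (_ → unitInterval) → _) := by fun_prop
    simp only [Measure.map_map hI hJ]
    have hIJ : Measurable (I.restrict ∘ J) := hI.comp hJ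
    have := Measure.isFiniteMeasure_map μ (I.restrict ∘ J)
    have := Measure.isFiniteMeasure_map ν (I.restrict ∘ J)
    refine (ext_of_moments fun k => ?_).symm
    have hmeas : Measurable fun x : I → unitInterval => ∏ i, (x i : ℝ) ^ k i :=
      Continuous.measurable (by fun_prop)
    rw [integral_map hIJ.aemeasurable hmeas.aestronglyMeasurable,
      integral_map hIJ.aemeasurable hmeas.aestronglyMeasurable]
    -- The moment of order `k` of the variables `exp (-m B)` is the Laplace functional at this step
    -- function.
    let f (x : E) : ℝ≥0∞ := ∑ B : I, (B.1.1).indicator (fun _ => (k B : ℝ≥0∞)) x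
    have hf : Measurable f :=
      Finset.measurable_sum _ fun B _ => measurable_const.indicator B.1.2
    have key (m : Measure E) : ∏ B : I, (((I.restrict ∘ J) m B : unitInterval) : ℝ) ^ k B =
        (expNeg (∫⁻ x, f x ∂m)).toReal := by
      rw [lintegral_finsetSum _ fun B _ => measurable_const.indicator B.1.2]
      simp_rw [lintegral_indicator_const (Subtype.prop (Subtype.val _)), expNeg_sum, expNeg_nsmul,
        ENNReal.toReal_prod, ENNReal.toReal_pow]
      rfl
    simp_rw [key]
    rw [integral_toReal, integral_toReal, h f hf]
    · exact (measurable_expNeg.comp (Measure.measurable_lintegral hf)).aemeasurable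
    · exact ae_of_all _ fun m => (expNeg_ne_top _).lt_top
    · exact (measurable_expNeg.comp (Measure.measurable_lintegral hf)).aemeasurable
    · exact ae_of_all _ fun m => (expNeg_ne_top _).lt_top
  ext s hs
  obtain ⟨t, ht, rfl⟩ := hcomap s hs
  rw [← Measure.map_apply hJ ht, ← Measure.map_apply hJ ht, hmap]

/-! ### Approximation by step functions and Laplace exponents -/

/-- Induction principle for `[0, ∞]`-valued measurable functions, along an exhausting sequence of
measurable sets. -/
theorem measurable_induction_of_exhaustion {E : Type*} [MeasurableSpace E] (S : ℕ → Set E)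
    (hS : ∀ m, MeasurableSet (S m)) (hmono : Monotone S) (hU : ⋃ m, S m = univ)
    {p : (E → ℝ≥0∞) → Prop}
    (simple : ∀ (n : ℕ) (a : Fin n → ℝ≥0) (B : Fin n → Set E), (∀ j, MeasurableSet (B j)) →
      (∃ m, ∀ j, B j ⊆ S m) → Pairwise (fun j k => Disjoint (B j) (B k)) →
      p fun x => ∑ j, (B j).indicator (fun _ => (a j : ℝ≥0∞)) x)
    (iSup : ∀ f : ℕ → E → ℝ≥0∞, (∀ n, Measurable (f n)) → Monotone f → (∀ n, p (f n)) →
      p fun x => ⨆ n, f n x)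
    {f : E → ℝ≥0∞} (hf : Measurable f) : p f := by
  -- Cutting off outside `S n` keeps every level set inside one set of the exhaustion; `eapprox` has
  -- finite values, so `toNNReal` below loses nothing.
  let g (n : ℕ) : E → ℝ≥0∞ := (S n).indicator (SimpleFunc.eapprox f n)
  have hg : Monotone g := fun n m hnm x =>
    (indicator_le_indicator (SimpleFunc.monotone_eapprox f hnm x)).trans
      (indicator_le_indicator_of_subset (hmono hnm) (fun _ => zero_le) x)
  have hfg : f = fun x => ⨆ n, g n x := by
    ext x
    refine le_antisymm ?_ (iSup_le fun n => ?_)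
    · rw [← SimpleFunc.iSup_eapprox_apply hf x]
      obtain ⟨k, hk⟩ := mem_iUnion.1 (hU ▸ mem_univ x)
      refine iSup_le fun n => le_iSup_of_le (max n k) ?_
      have : x ∈ S (max n k) := hmono (le_max_right _ _) hk
      simp only [g, indicator_of_mem this]
      exact SimpleFunc.monotone_eapprox f (le_max_left _ _) x
    · refine (indicator_le_self _ _ x).trans ?_
      rw [← SimpleFunc.iSup_eapprox_apply hf x]
      exact le_iSup (fun n => SimpleFunc.eapprox f n x) n
  rw [hfg]
  refine iSup g (fun n => (SimpleFunc.measurable _).indicator (hS n)) hg fun n => ?_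
  set h := SimpleFunc.eapprox f n with hh
  let e := h.range.equivFin.symm
  have hsum : g n = fun x => ∑ j, (S n ∩ h ⁻¹' {(e j).1}).indicator
      (fun _ => ((e j).1.toNNReal : ℝ≥0∞)) x := by
    ext x
    by_cases hx : x ∈ S n
    · rw [Finset.sum_eq_single (e.symm ⟨h x, h.mem_range_self x⟩)]
      · simp [g, hx, hh, (SimpleFunc.eapprox_lt_top f n x).ne]
      · intro j _ hj
        refine indicator_of_notMem (fun hxj => hj ?_) _
        rw [Equiv.eq_symm_apply]
        exact Subtype.ext hxj.2.symm
      · simp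
    · simp [g, hx]
  rw [hsum]
  refine simple _ _ _ (fun j => (hS n).inter (h.measurableSet_preimage _))
    ⟨n, fun j => inter_subset_left⟩ fun j k hjk => ?_
  refine Disjoint.mono inter_subset_right inter_subset_right ?_
  refine Disjoint.preimage h (disjoint_singleton.2 fun hjk' => hjk ?_)
  exact e.injective (Subtype.ext hjk')

/-- At most one summand is nonzero at each point; `F 0 = 0` covers the points outside all `B j`. -/
lemma comp_sum_indicator_of_disjoint {E ι : Type*} [Fintype ι] {B : ι → Set E}
    (hB : Pairwise (fun j k => Disjoint (B j) (B k))) (F : ℝ≥0∞ → ℝ≥0∞) (hF : F 0 = 0)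
    (a : ι → ℝ≥0∞) (x : E) :
    F (∑ j, (B j).indicator (fun _ => a j) x) = ∑ j, (B j).indicator (fun _ => F (a j)) x := by
  by_cases h : ∃ j, x ∈ B j
  · obtain ⟨j, hj⟩ := h
    have hne (k : ι) (hk : k ≠ j) : x ∉ B k := fun hxk => disjoint_left.1 (hB hk) hxk hj
    rw [Finset.sum_eq_single j, Finset.sum_eq_single j]
    · simp [hj]
    all_goals simp +contextual [hne]
  · push Not at h
    simp [h, hF]

/-- The Laplace exponent `∫ (1 - exp (-f)) dm` of a Poisson process with intensity `m`. -/
def laplaceExponent {E : Type*} [MeasurableSpace E] (f : E → ℝ≥0∞) (m : Measure E) : ℝ≥0∞ :=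
  ∫⁻ x, (1 - expNeg (f x)) ∂m

lemma measurable_one_sub_expNeg {E : Type*} [MeasurableSpace E] {f : E → ℝ≥0∞}
    (hf : Measurable f) : Measurable fun x => 1 - expNeg (f x) :=
  measurable_const.sub (measurable_expNeg.comp hf)

lemma measurable_laplaceExponent {E : Type*} [MeasurableSpace E] {f : E → ℝ≥0∞}
    (hf : Measurable f) : Measurable (laplaceExponent f) :=
  Measure.measurable_lintegral (measurable_one_sub_expNeg hf)

lemma laplaceExponent_mono {E : Type*} [MeasurableSpace E] {f g : E → ℝ≥0∞} (hfg : f ≤ g)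
    (m : Measure E) : laplaceExponent f m ≤ laplaceExponent g m :=
  lintegral_mono fun x => tsub_le_tsub_left (antitone_expNeg (hfg x)) 1

lemma tendsto_laplaceExponent {E : Type*} [MeasurableSpace E] {f : ℕ → E → ℝ≥0∞}
    {g : E → ℝ≥0∞} (hf : ∀ n, Measurable (f n)) (hmono : Monotone f)
    (hg : ∀ x, Tendsto (fun n => f n x) atTop (𝓝 (g x))) (m : Measure E) :
    Tendsto (fun n => laplaceExponent (f n) m) atTop (𝓝 (laplaceExponent g m)) := by
  refine lintegral_tendsto_of_tendsto_of_monotone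
    (fun n => (measurable_one_sub_expNeg (hf n)).aemeasurable)
    (ae_of_all _ fun x n k hnk => tsub_le_tsub_left (antitone_expNeg (hmono hnk x)) 1)
    (ae_of_all _ fun x => ?_)
  exact ENNReal.Tendsto.sub tendsto_const_nhds ((continuous_expNeg.tendsto _).comp (hg x))
    (Or.inl ENNReal.one_ne_top)

lemma laplaceExponent_sum_indicator {E ι : Type*} [MeasurableSpace E] [Fintype ι] {B : ι → Set E}
    (hBm : ∀ j, MeasurableSet (B j)) (hB : Pairwise (fun j k => Disjoint (B j) (B k)))
    (a : ι → ℝ≥0∞) (m : Measure E) :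
    laplaceExponent (fun x => ∑ j, (B j).indicator (fun _ => a j) x) m =
      ∑ j, m (B j) * (1 - expNeg (a j)) := by
  simp_rw [laplaceExponent, comp_sum_indicator_of_disjoint hB (fun y => 1 - expNeg y) (by simp)]
  rw [lintegral_finsetSum _ fun j _ => measurable_const.indicator (hBm j)]
  simp_rw [lintegral_indicator_const (hBm _), mul_comm]

lemma lintegral_sum_indicator {E ι : Type*} [MeasurableSpace E] [Fintype ι] {B : ι → Set E}
    (hBm : ∀ j, MeasurableSet (B j)) (a : ι → ℝ≥0∞) (m : Measure E) :
    ∫⁻ x, ∑ j, (B j).indicator (fun _ => a j) x ∂m = ∑ j, m (B j) * a j := by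
  rw [lintegral_finsetSum _ fun j _ => measurable_const.indicator (hBm j)]
  simp_rw [lintegral_indicator_const (hBm _), mul_comm]

lemma tendsto_lintegral_expNeg_lintegral {Ω E : Type*} [MeasurableSpace Ω] [MeasurableSpace E]
    {P : Measure Ω} [IsFiniteMeasure P] {X : Ω → Measure E} (hX : Measurable X)
    {f : ℕ → E → ℝ≥0∞} (hf : ∀ n, Measurable (f n)) (hmono : Monotone f) :
    Tendsto (fun n => ∫⁻ ω, expNeg (∫⁻ x, f n x ∂X ω) ∂P) atTop
      (𝓝 (∫⁻ ω, expNeg (∫⁻ x, ⨆ n, f n x ∂X ω) ∂P)) := by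
  refine lintegral_tendsto_of_tendsto_of_antitone
    (fun n => (measurable_expNeg.comp
      ((Measure.measurable_lintegral (hf n)).comp hX)).aemeasurable)
    (ae_of_all _ fun ω n k hnk => antitone_expNeg (lintegral_mono (hmono hnk))) ?_
    (ae_of_all _ fun ω => ?_)
  · refine ((lintegral_mono fun ω => expNeg_le_one _).trans_lt ?_).ne
    simp
  · rw [lintegral_iSup hf hmono]
    exact (continuous_expNeg.tendsto _).comp
      (tendsto_atTop_iSup fun n k hnk => lintegral_mono (hmono hnk))

/-! ### Laplace functional of a Poisson process -/

/-- With `b = exp (-a)`, each term is `exp (-r (1 - b))` times a weight of the Poisson law with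
parameter `r b`, whose total mass is 1. -/
lemma tsum_poissonMeasure_mul_expNeg (r a : ℝ≥0) :
    ∑' c : ℕ, poissonMeasure r {c} * expNeg (c * a) = expNeg (r * (1 - expNeg a)) := by
  let b : ℝ≥0 := ⟨Real.exp (-a), (Real.exp_pos _).le⟩
  have hb : expNeg a = b := by
    rw [expNeg_coe, ENNReal.ofReal_eq_coe_nnreal (Real.exp_pos _).le]
    rfl
  have hb1 : b ≤ 1 := by
    rw [← ENNReal.coe_le_coe, ← hb]; exact expNeg_le_one _
  have hterm (c : ℕ) : poissonMeasure r {c} * expNeg (c * a) =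
      ENNReal.ofReal (Real.exp (-(r * (1 - b) : ℝ≥0))) * poissonMeasure (r * b) {c} := by
    rw [expNeg_nsmul, poissonMeasure_singleton, poissonMeasure_singleton, expNeg_coe,
      ← ENNReal.ofReal_pow (Real.exp_pos _).le, ← ENNReal.ofReal_mul (by positivity),
      ← ENNReal.ofReal_mul (by positivity)]
    congr 1
    have hbr : (b : ℝ) = Real.exp (-a) := rfl
    have : Real.exp (-(r : ℝ)) =
        Real.exp (-((r * (1 - b) : ℝ≥0) : ℝ)) * Real.exp (-((r * b : ℝ≥0) : ℝ)) := by
      rw [← Real.exp_add, NNReal.coe_mul, NNReal.coe_sub hb1, NNReal.coe_mul]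
      congr 1
      push_cast
      ring
    rw [this, ← hbr]
    push_cast
    ring
  simp_rw [hterm]
  rw [ENNReal.tsum_mul_left]
  have h1 : ∑' c : ℕ, poissonMeasure (r * b) {c} = 1 := by
    rw [← measure_univ (μ := poissonMeasure (r * b)), ← lintegral_one, lintegral_countable']
    simp
  rw [h1, mul_one, hb, ← ENNReal.coe_one, ← ENNReal.coe_sub, ← ENNReal.coe_mul, expNeg_coe]

/-- The Laplace functional of a Poisson process. -/
theorem IsPoissonProcess.lintegral_expNeg {Ω E : Type*} [MeasurableSpace Ω] [TopologicalSpace E]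
    [MeasurableSpace E] {P : Measure Ω} [IsProbabilityMeasure P] {N : Ω → Measure E}
    {Λ : Measure E} [SigmaFinite Λ] (hN : IsPoissonProcess P N Λ) {f : E → ℝ≥0∞}
    (hf : Measurable f) :
    ∫⁻ ω, expNeg (∫⁻ x, f x ∂N ω) ∂P = expNeg (laplaceExponent f Λ) := by
  refine measurable_induction_of_exhaustion (spanningSets Λ) (measurableSet_spanningSets Λ)
    (monotone_spanningSets Λ) (iUnion_spanningSets Λ)
    (p := fun f => ∫⁻ ω, expNeg (∫⁻ x, f x ∂N ω) ∂P = expNeg (laplaceExponent f Λ)) ?_ ?_ hf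
  · rintro n a B hBm ⟨m, hm⟩ hB
    have hfin (j : Fin n) : Λ (B j) ≠ ∞ :=
      ((measure_mono (hm j)).trans_lt (measure_spanningSets_lt_top Λ m)).ne
    have hmeas (j : Fin n) : Measurable fun ω => N ω (B j) :=
      (Measure.measurable_coe (hBm j)).comp hN.measurable
    have hexp (j : Fin n) : Measurable fun y : ℝ≥0∞ => expNeg (y * a j) :=
      measurable_expNeg.comp (measurable_id.mul_const _)
    have hone (j : Fin n) : ∫⁻ ω, expNeg (N ω (B j) * a j) ∂P =
        expNeg (Λ (B j) * (1 - expNeg (a j))) := by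
      rw [← lintegral_map (hexp j) (hmeas j), hN.count _ (hBm j) (hfin j),
        lintegral_map (hexp j) (measurable_of_countable _), lintegral_countable']
      simp_rw [mul_comm (expNeg _)]
      rw [tsum_poissonMeasure_mul_expNeg, ENNReal.coe_toNNReal (hfin j)]
    simp_rw [lintegral_sum_indicator hBm, expNeg_sum]
    rw [lintegral_prod_eq_prod_lintegral_of_indepFun Finset.univ
      (fun j ω => expNeg (N ω (B j) * a j))
      ((hN.indep n B hBm hB).comp _ hexp) fun j => (hexp j).comp (hmeas j)]
    rw [laplaceExponent_sum_indicator hBm hB, expNeg_sum]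
    simp_rw [hone]
  · intro g hg hmono ih
    have h1 := tendsto_lintegral_expNeg_lintegral (P := P) hN.measurable hg hmono
    simp_rw [ih] at h1
    exact tendsto_nhds_unique h1 ((continuous_expNeg.tendsto _).comp
      (tendsto_laplaceExponent hg hmono
        (fun x => tendsto_atTop_iSup fun n k hnk => hmono hnk x) Λ))

/-! ### Conditionally independent Poisson processes -/

lemma ENNReal.tsum_prod_pi_fin (n : ℕ) (F : Fin n → ℕ → ℝ≥0∞) :
    ∑' c : Fin n → ℕ, ∏ k, F k (c k) = ∏ k, ∑' m, F k m := by
  induction n with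
  | zero => simp
  | succ n ih =>
    rw [← (Fin.consEquiv fun _ => ℕ).tsum_eq, ENNReal.tsum_prod', Fin.prod_univ_succ, ← ih,
      ← ENNReal.tsum_mul_right]
    simp [Fin.prod_univ_succ, Fin.consEquiv, ENNReal.tsum_mul_left]

lemma ENNReal.tsum_prod_pi {κ : Type*} [Fintype κ] (F : κ → ℕ → ℝ≥0∞) :
    ∑' c : κ → ℕ, ∏ k, F k (c k) = ∏ k, ∑' m, F k m := by
  let e := Fintype.equivFin κ
  rw [← e.symm.prod_comp, ← ENNReal.tsum_prod_pi_fin, ← (e.arrowCongr (Equiv.refl ℕ)).tsum_eq]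
  congr 1
  ext c
  rw [← e.symm.prod_comp]
  simp

lemma laplaceExponent_sum_measure {ι E : Type*} [MeasurableSpace E] (f : E → ℝ≥0∞)
    (m : ι → Measure E) :
    laplaceExponent f (Measure.sum m) = ∑' i, laplaceExponent f (m i) :=
  lintegral_sum_measure _ _

lemma measurable_measure_sum {Ω ι E : Type*} [MeasurableSpace Ω] [MeasurableSpace E] [Countable ι]
    {m : ι → Ω → Measure E} (hm : ∀ i, Measurable (m i)) :
    Measurable fun ω => Measure.sum fun i => m i ω := by
  refine Measure.measurable_of_measurable_coe _ fun s hs => ?_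
  simp_rw [Measure.sum_apply _ hs]
  exact Measurable.tsum fun i => (Measure.measurable_coe hs).comp (hm i)

/-- Dominated convergence with bound 1. It passes from finitely many lines, where the conditional
law is prescribed, to all of them. -/
lemma tendsto_lintegral_expNeg_sum {Ω ι : Type*} [MeasurableSpace Ω] {P : Measure Ω}
    [IsFiniteMeasure P] [Countable ι] {X : ι → Ω → ℝ≥0∞} (hX : ∀ i, Measurable (X i)) :
    Tendsto (fun I : Finset ι => ∫⁻ ω, expNeg (∑ i ∈ I, X i ω) ∂P) atTop
      (𝓝 (∫⁻ ω, expNeg (∑' i, X i ω) ∂P)) := by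
  refine tendsto_lintegral_filter_of_dominated_convergence (fun _ => 1)
    (Eventually.of_forall fun I => measurable_expNeg.comp (Finset.measurable_sum I fun i _ => hX i))
    (Eventually.of_forall fun I => ae_of_all _ fun ω => expNeg_le_one _) (by simp)
    (ae_of_all _ fun ω => ?_)
  exact (continuous_expNeg.tendsto _).comp ENNReal.summable.hasSum

lemma IsPointMeasure.exists_nat {E : Type*} [MetricSpace E] [ProperSpace E] [MeasurableSpace E]
    [MeasurableSingletonClass E] {m : Measure E} (hm : IsPointMeasure m) {B : Set E}
    (hBm : MeasurableSet B) (hB : Bornology.IsBounded B) : ∃ c : ℕ, m B = c := by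
  obtain ⟨s, hs, rfl⟩ := hm
  have hfin : (B ∩ s).Finite := (hs _ hB.isCompact_closure).subset fun x hx =>
    ⟨hx.2, subset_closure hx.1⟩
  exact ⟨_, by rw [Measure.restrict_apply hBm, Measure.count_apply_finite _ hfin]⟩

namespace IsCondIndepPoisson

variable {Ω ι E : Type*} {𝓖 : MeasurableSpace Ω} [mΩ : MeasurableSpace Ω] {P : Measure Ω}
  [IsProbabilityMeasure P] [MetricSpace E] [MeasurableSpace E]
  {φ Λ : ι → Ω → Measure E}

/-- Taking expectations in `condProb`. The Laplace functional is an unconditional expectation, so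
this integrated form is all that is needed. -/
lemma measure_eq_lintegral (hφ : IsCondIndepPoisson 𝓖 P φ Λ) (h𝓖 : 𝓖 ≤ mΩ) (I : Finset ι)
    {n : ℕ} {B : Fin n → Set E}
    (hBm : ∀ j, MeasurableSet (B j)) (hBb : ∀ j, Bornology.IsBounded (B j))
    (hB : Pairwise (fun j k => Disjoint (B j) (B k))) (c : ι → Fin n → ℕ) :
    P {ω | ∀ i ∈ I, ∀ j, φ i ω (B j) = (c i j : ℝ≥0∞)} =
      ∫⁻ ω, ∏ i ∈ I, ∏ j, poissonMeasure (Λ i ω (B j)).toNNReal {c i j} ∂P := by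
  have hmeas : MeasurableSet {ω | ∀ i ∈ I, ∀ j, φ i ω (B j) = (c i j : ℝ≥0∞)} := by
    have : {ω | ∀ i ∈ I, ∀ j, φ i ω (B j) = (c i j : ℝ≥0∞)} =
        ⋂ i ∈ I, ⋂ j, (fun ω => φ i ω (B j)) ⁻¹' {(c i j : ℝ≥0∞)} := by
      ext ω; simp
    rw [this]
    exact Finset.measurableSet_biInter _ fun i _ => MeasurableSet.iInter fun j =>
      ((Measure.measurable_coe (hBm j)).comp (hφ.pointProcess i).measurable)
        (measurableSet_singleton _)
  have hc := hφ.condProb I n B hBm hBb hB c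
  have hint := integrable_condExp.congr hc
  have h1 := integral_congr_ae hc
  rw [integral_condExp h𝓖, integral_indicator_const _ hmeas, smul_eq_mul, mul_one] at h1
  rw [← ofReal_measureReal, h1, ofReal_integral_eq_lintegral_ofReal hint
    (ae_of_all _ fun ω => by positivity)]
  refine lintegral_congr fun ω => ?_
  rw [ENNReal.ofReal_prod_of_nonneg fun i _ => by positivity]
  refine Finset.prod_congr rfl fun i _ => ?_
  rw [ENNReal.ofReal_prod_of_nonneg fun i _ => by positivity]
  exact Finset.prod_congr rfl fun j _ => ofReal_measureReal

variable [ProperSpace E] [BorelSpace E]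

lemma lintegral_expNeg_finset_sum (hφ : IsCondIndepPoisson 𝓖 P φ Λ) (h𝓖 : 𝓖 ≤ mΩ)
    (hΛ : ∀ i, Measurable (Λ i))
    (hfin : ∀ i ω (B : Set E), MeasurableSet B → Bornology.IsBounded B → Λ i ω B ≠ ∞)
    (I : Finset ι) {n : ℕ} {B : Fin n → Set E}
    (hBm : ∀ j, MeasurableSet (B j)) (hBb : ∀ j, Bornology.IsBounded (B j))
    (hB : Pairwise (fun j k => Disjoint (B j) (B k))) (a : Fin n → ℝ≥0) :
    ∫⁻ ω, expNeg (∑ i ∈ I, ∑ j, φ i ω (B j) * a j) ∂P =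
      ∫⁻ ω, expNeg (∑ i ∈ I, ∑ j, Λ i ω (B j) * (1 - expNeg (a j))) ∂P := by
  classical
  have hφm (i : ι) (j : Fin n) : Measurable fun ω => φ i ω (B j) :=
    (Measure.measurable_coe (hBm j)).comp (hφ.pointProcess i).measurable
  have hΛm (i : ι) (j : Fin n) : Measurable fun ω => Λ i ω (B j) :=
    (Measure.measurable_coe (hBm j)).comp (hΛ i)
  have hprod (F : ι → Fin n → ℝ≥0∞) :
      ∏ i ∈ I, ∏ j, F i j = ∏ k : I × Fin n, F k.1 k.2 := by
    rw [Fintype.prod_prod_type, Finset.prod_coe_sort I fun i => ∏ j, F i j]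
  -- `condProb` wants counts for every index; the value 0 outside `I` plays no role.
  let ex (c : I × Fin n → ℕ) (i : ι) (j : Fin n) : ℕ := if hi : i ∈ I then c (⟨i, hi⟩, j) else 0
  have hext (c : I × Fin n → ℕ) (k : I × Fin n) : ex c k.1 k.2 = c k := by
    simp [ex]
  let S (c : I × Fin n → ℕ) : Set Ω := {ω | ∀ k : I × Fin n, φ k.1 ω (B k.2) = (c k : ℝ≥0∞)}
  have hSm (c : I × Fin n → ℕ) : MeasurableSet (S c) := by
    have : S c = ⋂ k : I × Fin n, (fun ω => φ k.1 ω (B k.2)) ⁻¹' {(c k : ℝ≥0∞)} := by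
      ext ω; simp [S]
    rw [this]
    exact MeasurableSet.iInter fun k => hφm _ _ (measurableSet_singleton _)
  have hPS (c : I × Fin n → ℕ) :
      P (S c) = ∫⁻ ω, ∏ k : I × Fin n, poissonMeasure (Λ k.1 ω (B k.2)).toNNReal {c k} ∂P := by
    have hS : S c = {ω | ∀ i ∈ I, ∀ j, φ i ω (B j) = (ex c i j : ℝ≥0∞)} := by
      ext ω
      refine ⟨fun hω i hi j => ?_, fun hω k => ?_⟩
      · rw [hext c (⟨i, hi⟩, j)]; exact hω (⟨i, hi⟩, j)
      · rw [← hext c k]; exact hω _ k.1.2 _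
    rw [hS, hφ.measure_eq_lintegral h𝓖 I hBm hBb hB]
    refine lintegral_congr fun ω => ?_
    rw [hprod fun i j => poissonMeasure (Λ i ω (B j)).toNNReal {ex c i j}]
    simp_rw [hext]
  have hpois (c : ℕ) (i : ι) (j : Fin n) :
      Measurable fun ω => poissonMeasure (Λ i ω (B j)).toNNReal {c} := by
    simp_rw [poissonMeasure_singleton]
    have : Measurable fun r : ℝ≥0 => ENNReal.ofReal (Real.exp (-r) * r ^ c / c.factorial) := by
      fun_prop
    exact this.comp (hΛm i j).ennreal_toNNReal
  -- Counts in bounded sets are almost surely finite integers, so almost every `ω` lies in exactly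
  -- one `S c`.
  have hL : ∀ᵐ ω ∂P, expNeg (∑ i ∈ I, ∑ j, φ i ω (B j) * a j) =
      ∑' c : I × Fin n → ℕ, (S c).indicator (fun _ => ∏ k, expNeg (c k * a k.2)) ω := by
    have hpt : ∀ᵐ ω ∂P, ∀ i : I, IsPointMeasure (φ i ω) :=
      ae_all_iff.2 fun i => (hφ.pointProcess i).pointMeasure
    filter_upwards [hpt] with ω hω
    choose c hc using fun k : I × Fin n => (hω k.1).exists_nat (hBm k.2) (hBb k.2)
    rw [tsum_eq_single c]
    · rw [indicator_of_mem (show ω ∈ S c from hc), expNeg_sum]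
      simp_rw [expNeg_sum]
      rw [hprod fun i j => expNeg (φ i ω (B j) * a j)]
      simp_rw [hc]
    · intro d hd
      refine indicator_of_notMem (fun hωd => hd ?_) _
      ext k
      have := (hωd k).symm.trans (hc k)
      exact_mod_cast this
  have hR (ω : Ω) : expNeg (∑ i ∈ I, ∑ j, Λ i ω (B j) * (1 - expNeg (a j))) =
      ∑' c : I × Fin n → ℕ, (∏ k : I × Fin n, poissonMeasure (Λ k.1 ω (B k.2)).toNNReal {c k}) *
        ∏ k, expNeg (c k * a k.2) := by
    simp_rw [← Finset.prod_mul_distrib]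
    rw [ENNReal.tsum_prod_pi fun (k : I × Fin n) m =>
      poissonMeasure (Λ k.1 ω (B k.2)).toNNReal {m} * expNeg (m * a k.2)]
    simp_rw [tsum_poissonMeasure_mul_expNeg, expNeg_sum]
    rw [hprod fun i j => expNeg (Λ i ω (B j) * (1 - expNeg (a j)))]
    refine Finset.prod_congr rfl fun k _ => ?_
    rw [ENNReal.coe_toNNReal (hfin _ _ _ (hBm _) (hBb _))]
  rw [lintegral_congr_ae hL, lintegral_congr hR, lintegral_tsum, lintegral_tsum]
  · congr 1
    ext c
    rw [lintegral_indicator_const (hSm c), lintegral_mul_const, hPS, mul_comm]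
    exact Finset.measurable_prod _ fun k _ => hpois _ _ _
  · exact fun c => ((Finset.measurable_prod _ fun k _ => hpois _ _ _).mul_const _).aemeasurable
  · exact fun c => (measurable_const.indicator (hSm c)).aemeasurable

/-- The Laplace functional of a superposition of conditionally independent Poisson processes. -/
theorem lintegral_expNeg [Nonempty E] [Countable ι] (hφ : IsCondIndepPoisson 𝓖 P φ Λ) (h𝓖 : 𝓖 ≤ mΩ)
    (hΛ : ∀ i, Measurable (Λ i))
    (hfin : ∀ i ω (B : Set E), MeasurableSet B → Bornology.IsBounded B → Λ i ω B ≠ ∞)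
    {f : E → ℝ≥0∞} (hf : Measurable f) :
    ∫⁻ ω, expNeg (∫⁻ x, f x ∂(Measure.sum fun i => φ i ω)) ∂P =
      ∫⁻ ω, expNeg (laplaceExponent f (Measure.sum fun i => Λ i ω)) ∂P := by
  let x₀ : E := Classical.arbitrary E
  -- Balls serve as exhaustion because `condProb` speaks only of bounded sets.
  refine measurable_induction_of_exhaustion (fun m : ℕ => Metric.closedBall x₀ m)
    (fun m => Metric.isClosed_closedBall.measurableSet)
    (fun m k hmk => Metric.closedBall_subset_closedBall (by exact_mod_cast hmk))
    (Metric.iUnion_closedBall_nat x₀)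
    (p := fun f => ∫⁻ ω, expNeg (∫⁻ x, f x ∂(Measure.sum fun i => φ i ω)) ∂P =
      ∫⁻ ω, expNeg (laplaceExponent f (Measure.sum fun i => Λ i ω)) ∂P) ?_ ?_ hf
  · rintro n a B hBm ⟨m, hm⟩ hB
    have hBb (j : Fin n) : Bornology.IsBounded (B j) := Metric.isBounded_closedBall.subset (hm j)
    simp_rw [laplaceExponent_sum_measure, lintegral_sum_measure, lintegral_sum_indicator hBm,
      laplaceExponent_sum_indicator hBm hB]
    have h1 := tendsto_lintegral_expNeg_sum (P := P) (X := fun i ω => ∑ j, φ i ω (B j) * a j)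
      fun i => Finset.measurable_sum _ fun j _ =>
        ((Measure.measurable_coe (hBm j)).comp (hφ.pointProcess i).measurable).mul_const _
    have h2 := tendsto_lintegral_expNeg_sum (P := P)
      (X := fun i ω => ∑ j, Λ i ω (B j) * (1 - expNeg (a j)))
      fun i => Finset.measurable_sum _ fun j _ =>
        ((Measure.measurable_coe (hBm j)).comp (hΛ i)).mul_const _
    simp_rw [hφ.lintegral_expNeg_finset_sum h𝓖 hΛ hfin _ hBm hBb hB] at h1
    exact tendsto_nhds_unique h1 h2
  · intro g hg hmono ih
    have h1 := tendsto_lintegral_expNeg_lintegral (P := P)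
      (measurable_measure_sum fun i => (hφ.pointProcess i).measurable) hg hmono
    simp_rw [ih] at h1
    refine tendsto_nhds_unique h1 (lintegral_tendsto_of_tendsto_of_antitone
      (fun n => (measurable_expNeg.comp
        ((measurable_laplaceExponent (hg n)).comp (measurable_measure_sum hΛ))).aemeasurable)
      (ae_of_all _ fun ω n k hnk => antitone_expNeg (laplaceExponent_mono (hmono hnk) _)) ?_
      (ae_of_all _ fun ω => ?_))
    · refine ((lintegral_mono fun ω => expNeg_le_one _).trans_lt ?_).ne
      simp
    · exact (continuous_expNeg.tendsto _).comp (tendsto_laplaceExponent hg hmono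
        (fun x => tendsto_atTop_iSup fun n k hnk => hmono hnk x) _)

end IsCondIndepPoisson

/-! ### Lines under rigid motions -/

lemma measurable_linePoint : Measurable fun p : (ℝ × ℝ) × ℝ => linePoint p.1 p.2 := by
  refine (WithLp.measurable_toLp 2 _).comp (measurable_pi_lambda _ fun i => ?_)
  fin_cases i
  · simp only [Fin.zero_eta, Matrix.cons_val_zero]; fun_prop
  · simp only [Fin.mk_one, Matrix.cons_val_one, Matrix.cons_val_fin_one]; fun_prop

lemma measurable_linePoint_right (q : ℝ × ℝ) : Measurable (linePoint q) :=
  measurable_linePoint.comp measurable_prodMk_left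

lemma measurable_lineLength : Measurable lineLength := by
  refine Measure.measurable_of_measurable_coe _ fun s hs => ?_
  have h (q : ℝ × ℝ) : lineLength q s =
      volume (Prod.mk q ⁻¹' ((fun p : (ℝ × ℝ) × ℝ => linePoint p.1 p.2) ⁻¹' s)) := by
    rw [lineLength, Measure.map_apply (measurable_linePoint_right q) hs]
    rfl
  simp_rw [h]
  exact measurable_measure_prodMk_left (measurable_linePoint hs)

lemma abs_le_norm_linePoint (q : ℝ × ℝ) (s : ℝ) : |s| ≤ ‖linePoint q s‖ := by
  rw [EuclideanSpace.norm_eq]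
  refine Real.le_sqrt_of_sq_le ?_
  simp only [Fin.sum_univ_two, linePoint, Real.norm_eq_abs, sq_abs, Matrix.cons_val_zero,
    Matrix.cons_val_one, Matrix.cons_val_fin_one]
  nlinarith [Real.sin_sq_add_cos_sq q.2, sq_nonneg q.1]

lemma lineLength_ne_top (q : ℝ × ℝ) {B : Set Plane} (hBm : MeasurableSet B)
    (hB : Bornology.IsBounded B) : lineLength q B ≠ ∞ := by
  obtain ⟨R, hR⟩ := hB.subset_closedBall 0
  rw [lineLength, Measure.map_apply (measurable_linePoint_right q) hBm]
  refine ((measure_mono (t := Metric.closedBall (0 : ℝ) R) fun s hs => ?_).trans_lt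
    measure_closedBall_lt_top).ne
  have := hR hs
  rw [mem_closedBall_zero_iff] at this ⊢
  exact (abs_le_norm_linePoint q s).trans this

/-- A half turn of the direction gives the line with `r` negated, traversed backwards; Lebesgue
measure is invariant under `s ↦ -s`. -/
lemma lineLength_add_pi (r θ : ℝ) : lineLength (r, θ + Real.pi) = lineLength (-r, θ) := by
  have h : linePoint (r, θ + Real.pi) = linePoint (-r, θ) ∘ Neg.neg := by
    ext s i
    fin_cases i <;> simp [linePoint, Real.sin_add_pi, Real.cos_add_pi]
  rw [lineLength, h, ← Measure.map_map (measurable_linePoint_right _) measurable_neg,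
    Measure.map_neg_eq_self, lineLength]

/-- Rotation of the plane about the origin by the angle `α`, followed by the translation by `t`. -/
def rigidMotion (α : ℝ) (t : Plane) (x : Plane) : Plane :=
  !₂[Real.cos α * x 0 - Real.sin α * x 1 + t 0, Real.sin α * x 0 + Real.cos α * x 1 + t 1]

lemma measurable_rigidMotion (α : ℝ) (t : Plane) : Measurable (rigidMotion α t) := by
  refine (WithLp.measurable_toLp 2 _).comp (measurable_pi_lambda _ fun i => ?_)
  fin_cases i
  · simp only [Fin.zero_eta, Matrix.cons_val_zero]; fun_prop
  · simp only [Fin.mk_one, Matrix.cons_val_one, Matrix.cons_val_fin_one]; fun_prop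

/-- The component of `t` normal to the rotated line changes `r`; the tangential one only shifts arc
length. -/
lemma map_rigidMotion_lineLength (α : ℝ) (t : Plane) (q : ℝ × ℝ) :
    (lineLength q).map (rigidMotion α t) =
      lineLength (q.1 + (t 1 * Real.cos (q.2 + α) - t 0 * Real.sin (q.2 + α)), q.2 + α) := by
  have h : rigidMotion α t ∘ linePoint q =
      linePoint (q.1 + (t 1 * Real.cos (q.2 + α) - t 0 * Real.sin (q.2 + α)), q.2 + α) ∘
        fun s => s + (t 0 * Real.cos (q.2 + α) + t 1 * Real.sin (q.2 + α)) := by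
    have hsc := Real.sin_sq_add_cos_sq (q.2 + α)
    ext s i
    fin_cases i
    · simp only [rigidMotion, linePoint, Function.comp_apply, Fin.zero_eta, Matrix.cons_val_zero,
        Matrix.cons_val_one, Matrix.cons_val_fin_one]
      have : -q.1 * Real.sin (q.2 + α) + s * Real.cos (q.2 + α) =
          Real.cos α * (-q.1 * Real.sin q.2 + s * Real.cos q.2) -
            Real.sin α * (q.1 * Real.cos q.2 + s * Real.sin q.2) := by
        rw [Real.sin_add, Real.cos_add]; ring
      linear_combination -this - t 0 * hsc
    · simp only [rigidMotion, linePoint, Function.comp_apply, Fin.mk_one, Matrix.cons_val_zero,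
        Matrix.cons_val_one, Matrix.cons_val_fin_one]
      have : q.1 * Real.cos (q.2 + α) + s * Real.sin (q.2 + α) =
          Real.sin α * (-q.1 * Real.sin q.2 + s * Real.cos q.2) +
            Real.cos α * (q.1 * Real.cos q.2 + s * Real.sin q.2) := by
        rw [Real.sin_add, Real.cos_add]; ring
      linear_combination -this - t 1 * hsc
  rw [lineLength, Measure.map_map (measurable_rigidMotion α t) (measurable_linePoint_right q), h,
    ← Measure.map_map (measurable_linePoint_right _) (measurable_add_const _),
    map_add_right_eq_self, lineLength]

/-! ### Invariance of the line intensity -/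

lemma Function.Periodic.setLIntegral_Ico_add {f : ℝ → ℝ≥0∞} {T : ℝ} (hf : Function.Periodic f T)
    (hT : 0 < T) (α : ℝ) : ∫⁻ x in Ico 0 T, f (x + α) = ∫⁻ x in Ico 0 T, f x := by
  have h1 : ∫⁻ x in Ico 0 T, f (x + α) = ∫⁻ x in Ico α (α + T), f x := by
    have h := (measurePreserving_add_right (volume : Measure ℝ) α).setLIntegral_comp_preimage_emb
      (measurableEmbedding_addRight α) f (Ico α (α + T))
    rw [← h]
    congr 2
    ext x
    simp [add_comm α T]
  rw [h1, setLIntegral_congr Ico_ae_eq_Ioc, setLIntegral_congr Ico_ae_eq_Ioc]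
  have h2 := (isAddFundamentalDomain_Ioc hT α).setLIntegral_eq (isAddFundamentalDomain_Ioc hT 0) f
    hf.map_vadd_zmultiples
  simpa using h2

instance (lam : ℝ≥0) : SigmaFinite (lineIntensity lam) := by
  have : IsFiniteMeasure
      (ENNReal.ofReal Real.pi⁻¹ • (volume : Measure ℝ).restrict (Ico 0 Real.pi)) :=
    Measure.smul_finite _ ENNReal.ofReal_ne_top
  unfold lineIntensity
  infer_instance

lemma lintegral_lineIntensity (lam : ℝ≥0) {k : ℝ × ℝ → ℝ≥0∞} (hk : Measurable k) :
    ∫⁻ q, k q ∂lineIntensity lam =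
      lam * (ENNReal.ofReal Real.pi⁻¹ * ∫⁻ θ in Ico 0 Real.pi, ∫⁻ r, k (r, θ)) := by
  have : IsFiniteMeasure
      (ENNReal.ofReal Real.pi⁻¹ • (volume : Measure ℝ).restrict (Ico 0 Real.pi)) :=
    Measure.smul_finite _ ENNReal.ofReal_ne_top
  rw [lineIntensity, lintegral_smul_measure, lintegral_prod_symm _ hk.aemeasurable,
    lintegral_smul_measure]
  rfl

/-- For fixed `θ` the shift `ρ θ` is a translation in `r`. By `hpi` and the reflection `r ↦ -r` the
inner integral is `π`-periodic, so the shift by `α` over a full period is harmless. -/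
lemma lintegral_lineIntensity_shear (lam : ℝ≥0) {k : ℝ × ℝ → ℝ≥0∞} (hk : Measurable k)
    (hpi : ∀ r θ, k (r, θ + Real.pi) = k (-r, θ)) {ρ : ℝ → ℝ} (hρ : Measurable ρ) (α : ℝ) :
    ∫⁻ q, k (q.1 + ρ q.2, q.2 + α) ∂lineIntensity lam = ∫⁻ q, k q ∂lineIntensity lam := by
  have hper : Function.Periodic (fun θ => ∫⁻ r, k (r, θ)) Real.pi := fun θ => by
    simp_rw [hpi]
    exact (Measure.measurePreserving_neg (volume : Measure ℝ)).lintegral_comp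
      (f := fun r => k (r, θ)) (hk.comp measurable_prodMk_right)
  have hk' : Measurable fun q : ℝ × ℝ => k (q.1 + ρ q.2, q.2 + α) := hk.comp (by fun_prop)
  rw [lintegral_lineIntensity lam hk, lintegral_lineIntensity lam hk',
    ← hper.setLIntegral_Ico_add Real.pi_pos α]
  congr 2
  refine lintegral_congr fun θ => ?_
  exact lintegral_add_right_eq_self (fun r => k (r, θ + α)) (ρ θ)

/-! ### The Poisson line Cox process -/

lemma IsPoissonLineCox.measurable {Ω : Type*} [MeasurableSpace Ω] {P : Measure Ω} {lam mu : ℝ≥0}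
    {Φ : Ω → Measure Plane} (hΦ : IsPoissonLineCox P lam mu Φ) : Measurable Φ := by
  obtain ⟨q, φ, -, -, -, hφ, hsum⟩ := hΦ
  rw [funext hsum]
  exact measurable_measure_sum fun i => (hφ.pointProcess i).measurable

lemma measurable_nnreal_smul_measure {E : Type*} [MeasurableSpace E] (c : ℝ≥0) :
    Measurable fun m : Measure E => c • m := by
  refine Measure.measurable_of_measurable_coe _ fun s hs => ?_
  exact (Measure.measurable_coe hs).const_mul (c : ℝ≥0∞)

/-- The Laplace functional of a Poisson line Cox process. -/
theorem IsPoissonLineCox.lintegral_expNeg {Ω : Type*} [MeasurableSpace Ω] {P : Measure Ω}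
    [IsProbabilityMeasure P] {lam mu : ℝ≥0} {Φ : Ω → Measure Plane}
    (hΦ : IsPoissonLineCox P lam mu Φ) {f : Plane → ℝ≥0∞} (hf : Measurable f) :
    ∫⁻ ω, expNeg (∫⁻ x, f x ∂Φ ω) ∂P =
      expNeg (laplaceExponent (fun q => laplaceExponent f (mu • lineLength q))
        (lineIntensity lam)) := by
  obtain ⟨q, φ, hq, -, hN, hφ, hsum⟩ := hΦ
  have hlen : Measurable fun q => mu • lineLength q :=
    (measurable_nnreal_smul_measure mu).comp measurable_lineLength
  have hg : Measurable fun q => laplaceExponent f (mu • lineLength q) :=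
    (measurable_laplaceExponent hf).comp hlen
  simp_rw [hsum]
  rw [hφ.lintegral_expNeg (iSup_le fun i => (hq i).comap_le) (fun i => hlen.comp (hq i)) ?_ hf,
    ← hN.lintegral_expNeg hg]
  -- The exponent given the lines is the sum of its values at the `q i`, that is, an integral
  -- against the line process.
  · simp_rw [laplaceExponent_sum_measure, lintegral_sum_measure, lintegral_dirac' _ hg]
  · intro i ω B hBm hB
    rw [Measure.smul_apply]
    exact ENNReal.mul_ne_top ENNReal.coe_ne_top (lineLength_ne_top _ hBm hB)

/-- The distribution of a Poisson line Cox process is invariant under rigid motions. -/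
theorem IsPoissonLineCox.identDistrib_map_rigidMotion {Ω : Type*} [MeasurableSpace Ω]
    {P : Measure Ω} [IsProbabilityMeasure P] {lam mu : ℝ≥0} {Φ : Ω → Measure Plane}
    (hΦ : IsPoissonLineCox P lam mu Φ) (α : ℝ) (t : Plane) :
    IdentDistrib (fun ω => (Φ ω).map (rigidMotion α t)) Φ P P := by
  have hT := measurable_rigidMotion α t
  have hTΦ : Measurable fun ω => (Φ ω).map (rigidMotion α t) :=
    (Measure.measurable_map _ hT).comp hΦ.measurable
  refine ⟨hTΦ.aemeasurable, hΦ.measurable.aemeasurable, ?_⟩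
  have := Measure.isProbabilityMeasure_map (μ := P) hTΦ.aemeasurable
  have := Measure.isProbabilityMeasure_map (μ := P) hΦ.measurable.aemeasurable
  refine ext_of_laplace fun f hf => ?_
  have hL : Measurable fun m : Measure Plane => expNeg (∫⁻ x, f x ∂m) :=
    measurable_expNeg.comp (Measure.measurable_lintegral hf)
  rw [lintegral_map hL hTΦ, lintegral_map hL hΦ.measurable, hΦ.lintegral_expNeg hf]
  simp_rw [lintegral_map hf hT]
  rw [hΦ.lintegral_expNeg (f := fun x => f (rigidMotion α t x)) (hf.comp hT)]
  congr 1
  let k (q : ℝ × ℝ) : ℝ≥0∞ := 1 - expNeg (laplaceExponent f (mu • lineLength q))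
  have hk : Measurable k := measurable_one_sub_expNeg ((measurable_laplaceExponent hf).comp
    ((measurable_nnreal_smul_measure mu).comp measurable_lineLength))
  have hcomp (q : ℝ × ℝ) : laplaceExponent (fun x => f (rigidMotion α t x)) (mu • lineLength q) =
      laplaceExponent f (mu • lineLength
        (q.1 + (t 1 * Real.cos (q.2 + α) - t 0 * Real.sin (q.2 + α)), q.2 + α)) := by
    rw [← map_rigidMotion_lineLength, ← Measure.map_smul, laplaceExponent, laplaceExponent,
      lintegral_map (measurable_one_sub_expNeg hf) hT]
  have hinv := lintegral_lineIntensity_shear lam hk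
    (fun r θ => by simp only [k, lineLength_add_pi])
    (ρ := fun θ => t 1 * Real.cos (θ + α) - t 0 * Real.sin (θ + α)) (by fun_prop) α
  rw [laplaceExponent, laplaceExponent, ← hinv]
  exact lintegral_congr fun q => congrArg (fun y => 1 - expNeg y) (hcomp q)

end

theorem lemma1 {Ω : Type*} [MeasurableSpace Ω] (P : Measure Ω) [IsProbabilityMeasure P]
    (lam mu : ℝ≥0) (hlam : 0 < lam) (hmu : 0 < mu) (Φ : Ω → Measure Plane)
    (hΦ : IsPoissonLineCox P lam mu Φ) :
    (∀ t : Plane, IdentDistrib (fun ω => (Φ ω).map (fun x => x + t)) Φ P P) ∧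
    (∀ (c : Plane) (α : ℝ), IdentDistrib (fun ω => (Φ ω).map (planeRotation c α)) Φ P P) := by
  refine ⟨fun t => ?_, fun c α => ?_⟩
  · have h : (fun x : Plane => x + t) = rigidMotion 0 t := by
      ext x i
      fin_cases i <;> simp [rigidMotion]
    rw [h]
    exact hΦ.identDistrib_map_rigidMotion 0 t
  -- Rotation about `c` is rotation about the origin followed by translation by the image of the
  -- origin.
  · have h : planeRotation c α = rigidMotion α (planeRotation c α 0) := by
      ext x i
      fin_cases i <;> simp [rigidMotion, planeRotation] <;> ring
    rw [h]
    exact hΦ.identDistrib_map_rigidMotion α _
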